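/- Let $G$ be a simple graph embedded in the plane: the vertices of $G$ are represented by distinct points of the plane, each edge is represented by a simple arc joining the points that represent its two end vertices and passing through no other point that represents a vertex, and the arcs of two distinct edges meet at most in points that represent common end vertices of these edges. Let $C$ be a cycle of $G$ (on at least three distinct vertices). Then at most two vertices of $G$ are adjacent to every vertex of $C$. -/

import Mathlib

/-- The Euclidean plane. -/
abbrev Plane : Type := EuclideanSpace ℝ (Fin 2)

/-- `A` is a simple arc in the plane with end points `p` and `q`: the image of an injective
continuous curve, defined on the unit interval, from `p` to `q`. -/
def IsArc (A : Set Plane) (p q : Plane) : Prop :=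
  ∃ γ : Path p q, Function.Injective γ ∧ Set.range γ = A

/-- An embedding of the simple graph `G` in the plane. Vertices are drawn as distinct points and
edges as simple arcs. A graph together with such an embedding is a plane graph. -/
structure PlaneEmbedding {V : Type*} (G : SimpleGraph V) where
  /-- The point that represents a vertex. -/
  point : V → Plane
  /-- The arc that represents an edge. -/
  arc : G.edgeSet → Set Plane
  /-- Distinct vertices are represented by distinct points. -/
  point_injective : Function.Injective point
  /-- The arc of an edge is a simple arc whose end points represent the end vertices. -/
  isArc : ∀ (u v : V) (h : G.Adj u v),
    IsArc (arc ⟨s(u, v), G.mem_edgeSet.mpr h⟩) (point u) (point v)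
  /-- The only points on an arc that represent vertices are its end points. -/
  mem_of_point_mem_arc : ∀ (e : G.edgeSet) (v : V), point v ∈ arc e → v ∈ (e : Sym2 V)
  /-- Arcs of distinct edges intersect only at common end points. -/
  arc_inter : ∀ e f : G.edgeSet, e ≠ f → ∀ x : Plane, x ∈ arc e → x ∈ arc f →
    ∃ v : V, v ∈ (e : Sym2 V) ∧ v ∈ (f : Sym2 V) ∧ x = point v

open scoped unitInterval

/-! Three common neighbours and three vertices of the cycle would span a `K₃,₃` whose independent
edges are drawn as disjoint paths in `ℂ`. For two such edges `γ`, `δ`, the difference `γ s - δ t`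
never vanishes, so it has a continuous logarithm on the square, whose increments along the four
sides cancel (`logIncrement_sub_logIncrement`). The end points fix each increment up to a multiple
of `2πi`, so each pair of independent edges gives an equation in integers. Together these contradict
each other modulo 2 (`parity_obstruction`). -/

/-- The increment over the unit interval of a continuous logarithm of `f`, if there is one. -/
noncomputable def logIncrement (f : I → ℂ) : ℂ :=
  open Classical in
  if h : ∃ L : I → ℂ, Continuous L ∧ ∀ t, Complex.exp (L t) = f t then h.choose 1 - h.choose 0
  else 0

/-- Two lifts through the covering map `exp` that agree at one point are equal, so continuous
logarithms of one function differ by a constant. -/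
theorem sub_eq_sub_of_exp_eq {L K : I → ℂ} (hL : Continuous L) (hK : Continuous K)
    (h : ∀ t, Complex.exp (L t) = Complex.exp (K t)) : L 1 - L 0 = K 1 - K 0 := by
  have key : L = fun t ↦ K t + (L 0 - K 0) := by
    refine Complex.isCoveringMap_exp.eq_of_comp_eq hL (by fun_prop) ?_ 0 (by ring)
    funext t
    apply Subtype.ext
    change Complex.exp (L t) = Complex.exp (K t + (L 0 - K 0))
    rw [Complex.exp_add, Complex.exp_sub, h t, h 0, div_self (Complex.exp_ne_zero _), mul_one]
  have h1 := congrFun key 1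
  rw [h1]
  ring

theorem logIncrement_eq {f L : I → ℂ} (hL : Continuous L) (h : ∀ t, Complex.exp (L t) = f t) :
    logIncrement f = L 1 - L 0 := by
  have hex : ∃ L : I → ℂ, Continuous L ∧ ∀ t, Complex.exp (L t) = f t := ⟨L, hL, h⟩
  rw [logIncrement, dif_pos hex]
  refine sub_eq_sub_of_exp_eq hex.choose_spec.1 hL fun t ↦ ?_
  rw [hex.choose_spec.2, h]

theorem logIncrement_eq_of_neg {f L : I → ℂ} (hL : Continuous L)
    (h : ∀ t, Complex.exp (L t) = -f t) : logIncrement f = L 1 - L 0 := by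
  rw [logIncrement_eq (L := fun t ↦ L t + Real.pi * Complex.I) (by fun_prop)]
  · ring
  · intro t
    rw [Complex.exp_add, h, Complex.exp_pi_mul_I]
    ring

theorem exp_logIncrement {f : I → ℂ} (hf : Continuous f) (h0 : ∀ t, f t ≠ 0) :
    Complex.exp (logIncrement f) = f 1 / f 0 := by
  let F : C(I, {z : ℂ // z ≠ 0}) := ⟨fun t ↦ ⟨f t, h0 t⟩, by fun_prop⟩
  obtain ⟨L, hL, -⟩ := Complex.isCoveringMap_exp.exists_path_lifts F (Complex.log (f 0))
    (Subtype.ext (Complex.exp_log (h0 0)).symm)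
  have hL' (t : I) : Complex.exp (L t) = f t := congrArg Subtype.val (congrFun hL t)
  rw [logIncrement_eq L.continuous hL', Complex.exp_sub, hL', hL']

theorem exists_continuous_log_sub {a b c d : ℂ} (γ : Path a b) (δ : Path c d)
    (h : Disjoint (Set.range γ) (Set.range δ)) :
    ∃ L : I × I → ℂ, Continuous L ∧ ∀ s t, Complex.exp (L (s, t)) = γ s - δ t := by
  have h0 (x : I × I) : γ x.1 - δ x.2 ≠ 0 := fun hx ↦
    Set.disjoint_left.mp h ⟨x.1, rfl⟩ ⟨x.2, (sub_eq_zero.mp hx).symm⟩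
  let H : C(I × I, {z : ℂ // z ≠ 0}) := ⟨fun x ↦ ⟨γ x.1 - δ x.2, h0 x⟩, by fun_prop⟩
  let H₀ : C(I, {z : ℂ // z ≠ 0}) := ⟨fun t ↦ H (0, t), by fun_prop⟩
  obtain ⟨L, hL, -⟩ := Complex.isCoveringMap_exp.exists_path_lifts H₀ (Complex.log (H (0, 0)))
    (Subtype.ext (Complex.exp_log (H (0, 0)).2).symm)
  refine ⟨Complex.isCoveringMap_exp.liftHomotopy H L fun t ↦ (congrFun hL t).symm,
    ContinuousMap.continuous _, fun s t ↦ ?_⟩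
  exact congrArg Subtype.val
    (congrFun (Complex.isCoveringMap_exp.liftHomotopy_lifts H L _) (s, t))

/-- The total increment of a logarithm of `γ s - δ t` around the boundary of the unit square
vanishes. -/
theorem logIncrement_sub_logIncrement {a b c d : ℂ} (γ : Path a b) (δ : Path c d)
    (h : Disjoint (Set.range γ) (Set.range δ)) :
    logIncrement (fun s ↦ γ s - c) - logIncrement (fun s ↦ γ s - d) =
      logIncrement (fun t ↦ δ t - a) - logIncrement (fun t ↦ δ t - b) := by
  obtain ⟨L, hc, hL⟩ := exists_continuous_log_sub γ δ h
  rw [logIncrement_eq (L := fun s ↦ L (s, 0)) (by fun_prop) (fun s ↦ by simp [hL]),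
    logIncrement_eq (L := fun s ↦ L (s, 1)) (by fun_prop) (fun s ↦ by simp [hL]),
    logIncrement_eq_of_neg (L := fun t ↦ L (0, t)) (by fun_prop) (fun t ↦ by simp [hL]),
    logIncrement_eq_of_neg (L := fun t ↦ L (1, t)) (by fun_prop) (fun t ↦ by simp [hL])]
  ring

/-- Halve the equations and add the 18 with `i < k`. The left sides give 1 when `j < l` and 0
otherwise, in total 9. On the right each `n i j k` occurs twice, once for each `l ≠ j`, and likewise
each `m i j l`, so the sum is even. -/
theorem parity_obstruction (n m : Fin 3 → Fin 3 → Fin 3 → ℤ)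
    (h : ∀ i j k l, i ≠ k → j ≠ l → (if i < k then 1 else -1) + (if j < l then 1 else -1) =
      2 * (n k l i - n i j k + m i j l - m k l j)) : False := by
  have h1 := fun j l (hjl : j ≠ l) ↦ h 0 j 1 l (by decide) hjl
  have h2 := fun j l (hjl : j ≠ l) ↦ h 0 j 2 l (by decide) hjl
  have h3 := fun j l (hjl : j ≠ l) ↦ h 1 j 2 l (by decide) hjl
  have e1 := h1 0 1 (by decide)
  have e2 := h1 0 2 (by decide)
  have e3 := h1 1 2 (by decide)
  have e4 := h1 1 0 (by decide)
  have e5 := h1 2 0 (by decide)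
  have e6 := h1 2 1 (by decide)
  have e7 := h2 0 1 (by decide)
  have e8 := h2 0 2 (by decide)
  have e9 := h2 1 2 (by decide)
  have e10 := h2 1 0 (by decide)
  have e11 := h2 2 0 (by decide)
  have e12 := h2 2 1 (by decide)
  have e13 := h3 0 1 (by decide)
  have e14 := h3 0 2 (by decide)
  have e15 := h3 1 2 (by decide)
  have e16 := h3 1 0 (by decide)
  have e17 := h3 2 0 (by decide)
  have e18 := h3 2 1 (by decide)
  simp at e1 e2 e3 e4 e5 e6 e7 e8 e9 e10 e11 e12 e13 e14 e15 e16 e17 e18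
  omega

/-- A choice of logarithms of the differences `a i - a k` that changes by `π * I` when the
indices are swapped. -/
noncomputable def logDiff (a : Fin 3 → ℂ) (i k : Fin 3) : ℂ :=
  if i < k then Complex.log (a i - a k) else Complex.log (a k - a i) + Real.pi * Complex.I

theorem exp_logDiff {a : Fin 3 → ℂ} {i k : Fin 3} (h : a i ≠ a k) :
    Complex.exp (logDiff a i k) = a i - a k := by
  unfold logDiff
  split_ifs
  · exact Complex.exp_log (sub_ne_zero.mpr h)
  · rw [Complex.exp_add, Complex.exp_log (sub_ne_zero.mpr h.symm), Complex.exp_pi_mul_I]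
    ring

theorem logDiff_swap_sub (a : Fin 3 → ℂ) {i k : Fin 3} (h : i ≠ k) :
    logDiff a k i - logDiff a i k =
      ((if i < k then 1 else -1 : ℤ) : ℂ) * (Real.pi * Complex.I) := by
  unfold logDiff
  rcases lt_or_gt_of_ne h with h | h
  · simp [h, h.not_gt]
  · simp [h, h.not_gt]

/-- The complete bipartite graph on three and three vertices cannot be drawn in the plane so that
edges without a common end vertex are disjoint. -/
theorem not_disjoint_range_of_completeBipartite (a b : Fin 3 → ℂ) (γ : ∀ i j, Path (a i) (b j))
    (h : ∀ i j k l, i ≠ k → j ≠ l → Disjoint (Set.range (γ i j)) (Set.range (γ k l))) :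
    False := by
  have a_notMem (i j k : Fin 3) (hik : i ≠ k) : a k ∉ Set.range (γ i j) := by
    obtain ⟨l, hl⟩ := exists_ne j
    exact fun hx ↦ Set.disjoint_left.mp (h i j k l hik hl.symm) hx ⟨0, by simp⟩
  have b_notMem (i j l : Fin 3) (hjl : j ≠ l) : b l ∉ Set.range (γ i j) := by
    obtain ⟨k, hk⟩ := exists_ne i
    exact fun hx ↦ Set.disjoint_left.mp (h i j k l hk.symm hjl) hx ⟨1, by simp⟩
  have a_ne (i k : Fin 3) (hik : i ≠ k) : a i ≠ a k := fun e ↦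
    a_notMem i 0 k hik ⟨0, by simp [e]⟩
  have b_ne (j l : Fin 3) (hjl : j ≠ l) : b j ≠ b l := fun e ↦
    b_notMem 0 j l hjl ⟨1, by simp [e]⟩
  have ab_ne (k j : Fin 3) : b j ≠ a k := fun e ↦ by
    obtain ⟨i, hi⟩ := exists_ne k
    exact a_notMem i j k hi ⟨1, by simp [e]⟩
  have hn (i j k : Fin 3) : ∃ n : ℤ, i ≠ k → logIncrement (fun s ↦ γ i j s - a k) =
      Complex.log (b j - a k) - logDiff a i k + n * (2 * Real.pi * Complex.I) := by
    by_cases hik : i = k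
    · exact ⟨0, fun h ↦ (h hik).elim⟩
    have := exp_logIncrement (f := fun s ↦ γ i j s - a k) (by fun_prop)
      fun t ht ↦ a_notMem i j k hik ⟨t, sub_eq_zero.mp ht⟩
    simp only [Path.target, Path.source] at this
    rw [← exp_logDiff (a_ne i k hik), ← Complex.exp_log (sub_ne_zero.mpr (ab_ne k j)),
      ← Complex.exp_sub, Complex.exp_eq_exp_iff_exists_int] at this
    exact this.imp fun _ hx _ ↦ hx
  -- Writing the logarithm of `a i - b l` through that of `b l - a i`, as used in `hn`, makes all
  -- mixed terms cancel in `e` below.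
  have hm (i j l : Fin 3) : ∃ m : ℤ, j ≠ l → logIncrement (fun s ↦ γ i j s - b l) =
      logDiff b j l - (Complex.log (b l - a i) + Real.pi * Complex.I) +
        m * (2 * Real.pi * Complex.I) := by
    by_cases hjl : j = l
    · exact ⟨0, fun h ↦ (h hjl).elim⟩
    have := exp_logIncrement (f := fun s ↦ γ i j s - b l) (by fun_prop)
      fun t ht ↦ b_notMem i j l hjl ⟨t, sub_eq_zero.mp ht⟩
    have hlog : Complex.exp (Complex.log (b l - a i) + Real.pi * Complex.I) = a i - b l := by
      rw [Complex.exp_add, Complex.exp_log (sub_ne_zero.mpr (ab_ne i l)), Complex.exp_pi_mul_I]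
      ring
    simp only [Path.target, Path.source] at this
    rw [← exp_logDiff (b_ne j l hjl), ← hlog,
      ← Complex.exp_sub, Complex.exp_eq_exp_iff_exists_int] at this
    exact this.imp fun _ hx _ ↦ hx
  choose n hn using hn
  choose m hm using hm
  refine parity_obstruction n m fun i j k l hik hjl ↦ ?_
  have e := logIncrement_sub_logIncrement (γ i j) (γ k l) (h i j k l hik hjl)
  rw [hn i j k hik, hm i j l hjl, hn k l i hik.symm, hm k l j hjl.symm] at e
  have ea := logDiff_swap_sub a hik
  have eb := logDiff_swap_sub b hjl
  have hpi : (Real.pi * Complex.I : ℂ) ≠ 0 := by simp [Real.pi_ne_zero]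
  have : (((if i < k then 1 else -1) + (if j < l then 1 else -1) : ℤ) : ℂ) =
      ((2 * (n k l i - n i j k + m i j l - m k l j) : ℤ) : ℂ) := by
    refine mul_right_cancel₀ hpi ?_
    rw [Int.cast_add, add_mul, ← ea, ← eb]
    push_cast
    linear_combination e
  exact_mod_cast this

theorem SimpleGraph.Walk.IsCycle.three_le_encard_support {V : Type*} {G : SimpleGraph V} {a : V}
    {C : G.Walk a a} (hC : C.IsCycle) : 3 ≤ {w | w ∈ C.support}.encard := by
  classical
  have hsub : (C.support.tail.toFinset : Set V) ⊆ {w | w ∈ C.support} := fun w hw ↦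
    List.mem_of_mem_tail (List.mem_toFinset.mp hw)
  refine le_trans ?_ (Set.encard_le_encard hsub)
  rw [Set.encard_coe_eq_coe_finsetCard, List.toFinset_card_of_nodup hC.support_nodup,
    List.length_tail, SimpleGraph.Walk.length_support, Nat.add_sub_cancel]
  exact_mod_cast hC.three_le_length

theorem Set.exists_injective_fin_three {α : Type*} {s : Set α} (h : 3 ≤ s.encard) :
    ∃ f : Fin 3 → α, Function.Injective f ∧ ∀ i, f i ∈ s := by
  obtain ⟨t, hts, ht⟩ := Set.exists_subset_encard_eq h
  obtain ⟨x, y, z, hxy, hxz, hyz, rfl⟩ := Set.encard_eq_three.mp ht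
  refine ⟨![x, y, z], ?_, ?_⟩
  · intro i j hij
    fin_cases i <;> fin_cases j <;> simp_all
  · intro i
    fin_cases i <;> exact hts (by simp)

/-- In a plane graph, at most two vertices are adjacent to every vertex of a given cycle. -/
theorem corollary1 {V : Type*} (G : SimpleGraph V) (P : PlaneEmbedding G)
    {a : V} (C : G.Walk a a) (hC : C.IsCycle) :
    {v : V | ∀ w ∈ C.support, G.Adj v w}.encard ≤ 2 := by
  by_contra hcard
  have hcard : 3 ≤ {v : V | ∀ w ∈ C.support, G.Adj v w}.encard := by
    rw [not_le] at hcard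
    have := Order.add_one_le_of_lt hcard
    rwa [show (2 : ℕ∞) + 1 = 3 by norm_num] at this
  obtain ⟨v, hv, hvC⟩ := Set.exists_injective_fin_three hcard
  obtain ⟨w, hw, hwC⟩ := Set.exists_injective_fin_three hC.three_le_encard_support
  have adj (i j : Fin 3) : G.Adj (v i) (w j) := hvC i (w j) (hwC j)
  have hvw (i j : Fin 3) : v i ≠ w j := (adj i j).ne
  choose γ _ hγ using fun i j ↦ P.isArc (v i) (w j) (adj i j)
  let φ := Complex.orthonormalBasisOneI.repr.symm
  refine not_disjoint_range_of_completeBipartite (fun i ↦ φ (P.point (v i)))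
    (fun j ↦ φ (P.point (w j))) (fun i j ↦ (γ i j).map φ.continuous) fun i j k l hik hjl ↦ ?_
  rw [Set.disjoint_left]
  rintro _ ⟨s, rfl⟩ ⟨t, ht⟩
  have hst : γ k l t = γ i j s := φ.injective ht
  obtain ⟨u, hu, hu', -⟩ := P.arc_inter ⟨s(v i, w j), adj i j⟩ ⟨s(v k, w l), adj k l⟩
    (fun e ↦ by simpa [hv.ne hik, hvw] using congrArg Subtype.val e) (γ i j s) (hγ i j ▸ ⟨s, rfl⟩) (hγ k l ▸ ⟨t, hst⟩)
  -- A common point would force a common end vertex, but the two edges have none.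
  rw [Sym2.mem_iff] at hu hu'
  rcases hu with rfl | rfl <;> rcases hu' with e | e
  exacts [hik (hv e), hvw _ _ e, hvw _ _ e.symm, hjl (hw e)]
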